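/- Let $(M^n,g)$ be a smooth Riemannian $n$-manifold with Levi-Civita connection $\nabla$, equipped with a spin structure, and let $S$ be the associated complex spinor bundle (associated with an irreducible complex representation of the Clifford algebra $Cl(n)$, with the convention $v\cdot v=-|v|^2$). Let $c:TM\to \mathrm{End}(S)$ be Clifford multiplication, denote by $\nabla$ also the connections induced on $S$ and on $\mathrm{End}(S)$, and, for an orthonormal frame $(e_j)$, let $\slashed{D}=\sum_j c(e_j)\nabla_{e_j}$ be the Dirac operator on spinor fields. For a section $A$ of $\mathrm{End}(S)$ put $\slashed{D}A=\sum_j c(e_j)\,\nabla_{e_j}A$, again a section of $\mathrm{End}(S)$. For a section $B$ of $\mathrm{End}(S)$, a smooth section $A$ of $\mathrm{End}(S)$ is called an integrating factor for the Dirac–Schrödinger operator $\slashed{D}+B$ if $A$ is invertible at every point and $$A^{-1}(\slashed{D}A)=B .$$ For a vector field $X$ put $$\mathrm{div}\,X=\sum_j g(\nabla_{e_j}X,e_j),\qquad \mathrm{curl}\,X=\sum_{m<j}\bigl[g(\nabla_{e_m}X,e_j)-g(\nabla_{e_j}X,e_m)\bigr]\,c(e_m)c(e_j).$$ 1. If $f\in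 C^\infty(M)$ is real-valued and $B=c(\nabla f)$, then $A=\exp(f)$ is an integrating factor for $\slashed{D}+B$. In this case, moreover, $\slashed{D}(A\psi)=A(\slashed{D}+B)\psi$ for every spinor field $\psi$. 2. If $X$ is a nowhere vanishing smooth vector field on $M$ and $B=\dfrac{c(X)}{|X|^2}\bigl[(\mathrm{div}\,X)-(\mathrm{curl}\,X)\bigr]$, then $A=c(X)$ is an integrating factor for $\slashed{D}+B$. -/

import Mathlib

open Bundle
open scoped Manifold ContDiff

noncomputable section

namespace DiracSchrodinger

/-- The model Euclidean space `ℝⁿ`. -/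
abbrev Eu (n : ℕ) : Type := EuclideanSpace ℝ (Fin n)

/-- The quadratic form `v ↦ -|v|²` on `ℝⁿ`. -/
def negNormSq (n : ℕ) : QuadraticForm ℝ (Eu n) :=
  -(LinearMap.BilinMap.toQuadraticMap (innerₗ (Eu n)))

/-- The real Clifford algebra `Cl(n)`, with `v * v = -|v|²` for `v ∈ ℝⁿ`. -/
abbrev Cl (n : ℕ) : Type := CliffordAlgebra (negNormSq n)

/-- The group `Spin(n)`, inside `Cl(n)`. -/
abbrev Spin (n : ℕ) : Type := spinGroup (negNormSq n)

theorem ι_sq (n : ℕ) (v : Eu n) :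
    CliffordAlgebra.ι (negNormSq n) v * CliffordAlgebra.ι (negNormSq n) v =
      algebraMap ℝ (Cl n) (-(‖v‖ ^ 2)) := by
  rw [CliffordAlgebra.ι_sq_scalar]
  congr 1
  simp [negNormSq]

section Spinors

/-- A complex spinor module: a (nonzero) irreducible complex representation of the Clifford
algebra `Cl(n)`. -/
def IsSpinorModule {n : ℕ} {Δ : Type*} [AddCommGroup Δ] [Module ℂ Δ]
    (ρ : Cl n →ₐ[ℝ] Module.End ℂ Δ) : Prop :=
  Nontrivial Δ ∧ ∀ W : Submodule ℂ Δ, (∀ a : Cl n, ∀ w ∈ W, ρ a w ∈ W) → W = ⊥ ∨ W = ⊤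

end Spinors

section Manifold

variable {n : ℕ} {M : Type*} [TopologicalSpace M] [ChartedSpace (Eu n) M]
  [RiemannianBundle (fun x : M ↦ TangentSpace (𝓡 n) x)]

variable (n M) in
/-- A spin structure on a Riemannian `n`-manifold `M`, given by gluing data: an open cover with
a smooth orthonormal frame of `TM` over every member of the cover, and, on the overlaps, smooth
`Spin(n)`-valued functions that satisfy the cocycle identity and lift the transition functions of
the frames through the double cover `Spin(n) → SO(n)`, `g ↦ (v ↦ g v g⁻¹)`. -/
structure SpinStructure [IsManifold (𝓡 n) ∞ M] (ι : Type*) where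
  /-- the open cover -/
  baseSet : ι → Set M
  isOpen_baseSet : ∀ a, IsOpen (baseSet a)
  /-- a choice, for every point, of a member of the cover that contains it -/
  indexAt : M → ι
  mem_baseSet_at : ∀ x, x ∈ baseSet (indexAt x)
  /-- the local frames (only their values over `baseSet a` matter) -/
  frame : ι → Fin n → ∀ x : M, TangentSpace (𝓡 n) x
  contMDiffOn_frame : ∀ a i, ContMDiffOn (𝓡 n) (𝓡 n).tangent ∞
    (fun x ↦ (⟨x, frame a i x⟩ : TangentBundle (𝓡 n) M)) (baseSet a)
  orthonormal_frame : ∀ a, ∀ x ∈ baseSet a, Orthonormal ℝ (fun i ↦ frame a i x)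
  /-- the transition functions; `lift a b` passes from the frame `a` to the frame `b` -/
  lift : ι → ι → M → Spin n
  /-- smoothness, tested on the linear functions on the finite-dimensional space `Cl(n)` -/
  contMDiffOn_lift : ∀ a b, ∀ φ : Cl n →ₗ[ℝ] ℝ, ContMDiffOn (𝓡 n) 𝓘(ℝ, ℝ) ∞
    (fun x ↦ φ (lift a b x : Cl n)) (baseSet a ∩ baseSet b)
  lift_comp : ∀ a b c, ∀ x ∈ baseSet a ∩ baseSet b ∩ baseSet c,
    lift b c x * lift a b x = lift a c x
  lift_frame : ∀ a b, ∀ x ∈ baseSet a ∩ baseSet b, ∀ v : TangentSpace (𝓡 n) x,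
    CliffordAlgebra.ι (negNormSq n) (WithLp.toLp 2 fun i ↦ inner ℝ (frame b i x) v) =
      (lift a b x : Cl n) *
        CliffordAlgebra.ι (negNormSq n) (WithLp.toLp 2 fun i ↦ inner ℝ (frame a i x) v) *
        ((lift a b x)⁻¹ : Spin n)

variable [IsManifold (𝓡 n) ∞ M]

/-- A connection on the tangent bundle is the Levi-Civita connection if it is torsion-free and
compatible with the metric. -/
def IsLeviCivita
    [IsContMDiffRiemannianBundle (𝓡 n) ∞ (Eu n) (fun x : M ↦ TangentSpace (𝓡 n) x)]
    (nabla : CovariantDerivative (𝓡 n) (Eu n) (fun x : M ↦ TangentSpace (𝓡 n) x)) : Prop :=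
  haveI : IsContMDiffRiemannianBundle (𝓡 n) 1 (Eu n) (fun x : M ↦ TangentSpace (𝓡 n) x) :=
    IsContMDiffRiemannianBundle.of_le (n := ∞) (by norm_cast)
  nabla.torsion = 0 ∧ nabla.IsMetricCompatible

namespace SpinStructure

variable {ι : Type*} (σ : SpinStructure n M ι)

/-- The components of a tangent vector in the frame `a`. -/
def coords (a : ι) (x : M) (v : TangentSpace (𝓡 n) x) : Eu n :=
  WithLp.toLp 2 fun i ↦ inner ℝ (σ.frame a i x) v

theorem lift_self {a : ι} {x : M} (hx : x ∈ σ.baseSet a) : σ.lift a a x = 1 :=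
  mul_eq_left.mp (σ.lift_comp a a a x ⟨⟨hx, hx⟩, hx⟩)

variable {Δ : Type*} [NormedAddCommGroup Δ] [NormedSpace ℂ Δ] [FiniteDimensional ℂ Δ]
  (ρ : Cl n →ₐ[ℝ] Module.End ℂ Δ)

/-- The spinor bundle `P_Spin ×_ρ Δ`, glued with the transition functions `ρ (lift a b)`. -/
def spinorCore : VectorBundleCore ℝ M Δ ι where
  baseSet := σ.baseSet
  isOpen_baseSet := σ.isOpen_baseSet
  indexAt := σ.indexAt
  mem_baseSet_at := σ.mem_baseSet_at
  coordChange a b x := LinearMap.toContinuousLinearMap ((ρ (σ.lift a b x : Cl n)).restrictScalars ℝ)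
  coordChange_self a x hx v := by simp [σ.lift_self hx]
  continuousOn_coordChange a b := by
    rw [continuousOn_clm_apply]
    intro y
    let bas := Module.finBasis ℝ Δ
    have h : ContinuousOn (fun x ↦ bas.equivFunL (ρ (σ.lift a b x : Cl n) y))
        (σ.baseSet a ∩ σ.baseSet b) := by
      refine continuousOn_pi.2 fun i ↦ ?_
      let φ : Cl n →ₗ[ℝ] ℝ :=
        { toFun := fun g ↦ bas.equivFun (ρ g y) i
          map_add' := fun g h ↦ by simp
          map_smul' := fun r g ↦ by simp }
      exact (σ.contMDiffOn_lift a b φ).continuousOn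
    have h' := bas.equivFunL.symm.continuous.comp_continuousOn h
    refine h'.congr fun x _ ↦ ?_
    simp
  coordChange_comp a b c x hx v := by
    simp [← σ.lift_comp a b c x hx]

/-- The fibre `S_x` of the spinor bundle. -/
abbrev Spinor (x : M) : Type _ := (σ.spinorCore ρ).Fiber x

/-- The fibres of the spinor bundle are complex vector spaces. -/
instance moduleSpinor (x : M) : Module ℂ (σ.Spinor ρ x) := inferInstanceAs (Module ℂ Δ)

/-- The expression of a spinor field in the frame `a`. -/
def localRep (ψ : ∀ x, σ.Spinor ρ x) (a : ι) (y : M) : Δ :=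
  (σ.spinorCore ρ).coordChange (σ.indexAt y) a y (ψ y)

/-- Clifford multiplication `c(v) : S_x → S_x` by a tangent vector `v ∈ T_x M`. -/
def cliff (x : M) (v : TangentSpace (𝓡 n) x) : Module.End ℂ (σ.Spinor ρ x) :=
  (ρ (CliffordAlgebra.ι (negNormSq n) (σ.coords (σ.indexAt x) x v)) : Module.End ℂ Δ)

/-- The spinor connection induced by `nabla`: in a frame `(ε_i)` of the spin structure,
`∇_v ψ = dψ(v) + (1/4) ∑ i j, g(∇_v ε_i, ε_j) ε_i ε_j ψ`. (At `x` we use the frame with index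
`indexAt x`; the fibre `S_x` is identified with `Δ` in this same frame.) -/
def spinNabla (nabla : CovariantDerivative (𝓡 n) (Eu n) (fun x : M ↦ TangentSpace (𝓡 n) x))
    (ψ : ∀ x, σ.Spinor ρ x) (x : M) (v : TangentSpace (𝓡 n) x) : σ.Spinor ρ x :=
  (show σ.Spinor ρ x from mvfderiv (𝓡 n) (σ.localRep ρ ψ (σ.indexAt x)) x v) +
    ((1 / 4 : ℝ) : ℂ) • ∑ i, ∑ j,
      ((inner ℝ (nabla (σ.frame (σ.indexAt x) i) x v) (σ.frame (σ.indexAt x) j x) : ℝ) : ℂ) •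
        (σ.cliff ρ x (σ.frame (σ.indexAt x) i x)
          (σ.cliff ρ x (σ.frame (σ.indexAt x) j x) (ψ x)))

/-- Smoothness of a section of `End(S)`: it maps (locally) smooth spinor fields to smooth
spinor fields. -/
def IsSmoothEnd (A : ∀ x, Module.End ℂ (σ.Spinor ρ x)) : Prop :=
  ∀ (x : M) (ψ : ∀ y, σ.Spinor ρ y),
    ContMDiffAt (𝓡 n) ((𝓡 n).prod 𝓘(ℝ, Δ)) ∞ (fun y ↦ TotalSpace.mk' Δ y (ψ y)) x →
    ContMDiffAt (𝓡 n) ((𝓡 n).prod 𝓘(ℝ, Δ)) ∞ (fun y ↦ TotalSpace.mk' Δ y (A y (ψ y))) x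

variable (nabla : CovariantDerivative (𝓡 n) (Eu n) (fun x : M ↦ TangentSpace (𝓡 n) x))
  (e : ∀ x : M, OrthonormalBasis (Fin n) ℝ (TangentSpace (𝓡 n) x))

/-- The Dirac operator `D ψ = ∑ j, c(e_j) ∇_{e_j} ψ`. Here and below, `e` is an arbitrary choice
of an orthonormal basis of every tangent space; it need not depend continuously on the point. -/
def dirac (ψ : ∀ x, σ.Spinor ρ x) (x : M) : σ.Spinor ρ x :=
  ∑ j, σ.cliff ρ x (e x j) (σ.spinNabla ρ nabla ψ x (e x j))

/-- The Dirac-Schrödinger operator `D + B`. -/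
def diracSchrodinger (B : ∀ x, Module.End ℂ (σ.Spinor ρ x)) (ψ : ∀ x, σ.Spinor ρ x) (x : M) :
    σ.Spinor ρ x :=
  σ.dirac ρ nabla e ψ x + B x (ψ x)

/-- The covariant derivative of a section of `End(S)`, in the connection induced on `End(S)`, and
applied to a spinor field: `(∇_v A) ψ = ∇_v (A ψ) - A (∇_v ψ)`. -/
def endNabla (A : ∀ x, Module.End ℂ (σ.Spinor ρ x)) (ψ : ∀ x, σ.Spinor ρ x) (x : M)
    (v : TangentSpace (𝓡 n) x) : σ.Spinor ρ x :=
  σ.spinNabla ρ nabla (fun y ↦ A y (ψ y)) x v - A x (σ.spinNabla ρ nabla ψ x v)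

/-- The Dirac operator on sections of `End(S)`: `D A = ∑ j, c(e_j) (∇_{e_j} A)`, applied to a
spinor field. -/
def endDirac (A : ∀ x, Module.End ℂ (σ.Spinor ρ x)) (ψ : ∀ x, σ.Spinor ρ x) (x : M) :
    σ.Spinor ρ x :=
  ∑ j, σ.cliff ρ x (e x j) (σ.endNabla ρ nabla A ψ x (e x j))

/-- `A` is an integrating factor for `D + B`: it is a smooth invertible section of `End(S)`
and `A⁻¹ (D A) = B` (tested on the spinor fields that are differentiable at the point). -/
def IsIntegratingFactor (B A : ∀ x, Module.End ℂ (σ.Spinor ρ x)) : Prop :=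
  σ.IsSmoothEnd ρ A ∧ (∀ x, IsUnit (A x)) ∧
    ∀ (x : M) (ψ : ∀ y, σ.Spinor ρ y),
      MDifferentiableAt (𝓡 n) ((𝓡 n).prod 𝓘(ℝ, Δ)) (fun y ↦ TotalSpace.mk' Δ y (ψ y)) x →
      Ring.inverse (A x) (σ.endDirac ρ nabla e A ψ x) = B x (ψ x)

/-- The curl of a vector field, as a section of `End(S)`:
`∑ m < j, (g(∇_{e_m} X, e_j) - g(∇_{e_j} X, e_m)) c(e_m) c(e_j)`. -/
def curl (X : ∀ x : M, TangentSpace (𝓡 n) x) (x : M) : Module.End ℂ (σ.Spinor ρ x) :=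
  ∑ m, ∑ j ∈ Finset.Ioi m,
    ((inner ℝ (nabla X x (e x m)) (e x j) - inner ℝ (nabla X x (e x j)) (e x m) : ℝ) : ℂ) •
      (σ.cliff ρ x (e x m) * σ.cliff ρ x (e x j))

end SpinStructure

/-- The gradient `∑ j, df(e_j) e_j` of a function. -/
def grad (e : ∀ x : M, OrthonormalBasis (Fin n) ℝ (TangentSpace (𝓡 n) x)) (f : M → ℝ) (x : M) :
    TangentSpace (𝓡 n) x :=
  ∑ j, (mvfderiv (𝓡 n) f x (e x j) : ℝ) • e x j

/-- The divergence `∑ j, g(∇_{e_j} X, e_j)` of a vector field. -/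
def divergence (nabla : CovariantDerivative (𝓡 n) (Eu n) (fun x : M ↦ TangentSpace (𝓡 n) x))
    (e : ∀ x : M, OrthonormalBasis (Fin n) ℝ (TangentSpace (𝓡 n) x))
    (X : ∀ x : M, TangentSpace (𝓡 n) x) (x : M) : ℝ :=
  ∑ j, inner ℝ (nabla X x (e x j)) (e x j)

end Manifold

end DiracSchrodinger

end

/-! Scalar case: the Leibniz rule gives `∇_v (exp f • ψ) = exp f • (∇_v ψ + df(v) ψ)`. Contracting
with `c(e_j)` and using `c(∇f) = ∑ df(e_j) c(e_j)` yields both the integrating factor and the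
intertwining identity (`dirac_exp_smul`, `isIntegratingFactor_exp`).

Vector case: Clifford multiplication is parallel, `∇_v (c(X)) = c(∇_v X)` (`endNabla_cliff`), so `D
(c(X)) = ∑ c(e_j) c(∇_{e_j} X)`. Expanding `∇_{e_j} X` in the basis `e` and separating the diagonal
from the anticommuting off-diagonal terms gives `-(div X - curl X)` (`sum_cliff_mul_cliff`). Since
`c(X)² = -|X|²`, the inverse of `c(X)` is `-c(X)/|X|²`, and the two signs cancel.

Parallelism is checked in one frame of the spin structure, where Clifford multiplication is a
constant bilinear map. The product rule leaves the derivative of the coordinates of `X`, which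
differs from the coordinates of `∇_v X` by a connection term (`mvfderiv_coords`). The commutator of
the spin connection form with `c(X)` supplies exactly this term (`spinForm_commutator_cliff`). The
basis `e` is never differentiated. -/

namespace DiracSchrodinger

/-! ### Identities for anticommuting Clifford generators -/

section Algebra

variable {R : Type*} [Ring R] [Algebra ℂ R]

/-- The spin representation of a skew matrix acts on Clifford generators by the matrix. -/
theorem spin_commutator {κ : Type*} [Fintype κ] [DecidableEq κ] (E : κ → R)
    (hE : ∀ i j, E i * E j + E j * E i = (if i = j then (-2 : ℂ) else 0) • 1)
    (w : κ → κ → ℂ) (hw : ∀ i j, w i j = -w j i) (k : κ) :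
    (∑ i, ∑ j, w i j • (E i * E j)) * E k - E k * (∑ i, ∑ j, w i j • (E i * E j)) =
      (4 : ℂ) • ∑ j, w k j • E j := by
  have h1 : ∀ i j, (E i * E j) * E k - E k * (E i * E j) =
      (if j = k then (-2 : ℂ) else 0) • E i - (if i = k then (-2 : ℂ) else 0) • E j := by
    intro i j
    have : (E i * E j) * E k - E k * (E i * E j) =
        E i * (E j * E k + E k * E j) - (E i * E k + E k * E i) * E j := by noncomm_ring
    rw [this, hE, hE]
    simp
  simp only [Finset.sum_mul, Finset.mul_sum, smul_mul_assoc, mul_smul_comm,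
    ← Finset.sum_sub_distrib, ← smul_sub, h1]
  have h2 : ∀ i j, w i j • ((if j = k then (-2 : ℂ) else 0) • E i -
      (if i = k then (-2 : ℂ) else 0) • E j) =
      (if j = k then (-2 * w i k) • E i else 0) + (if i = k then (2 * w k j) • E j else 0) := by
    intro i j
    clear hw hE h1
    split_ifs with h h' h'
    · subst h h'; simp [mul_comm]
    · subst h; simp [smul_smul, mul_comm]
    · subst h'; simp [smul_smul, mul_comm]
    · simp
  simp only [h2, Finset.sum_add_distrib, Finset.sum_ite_eq', Finset.mem_univ, if_true]
  rw [Finset.sum_comm (f := fun i j ↦ if i = k then (2 * w k j) • E j else 0)]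
  simp only [Finset.sum_ite_eq', Finset.mem_univ, if_true]
  rw [Finset.smul_sum, ← Finset.sum_add_distrib]
  refine Finset.sum_congr rfl fun i _ ↦ ?_
  -- Skew-symmetry makes the two contributions `-2 w i k` and `2 w k i` equal, whence the factor 4.
  rw [hw i k, ← add_smul, smul_smul]
  congr 1
  ring

/-- Diagonal terms contribute the trace because `E j * E j = -1`; each term below the diagonal is
folded onto its mirror image, with a sign from anticommutation. With `a j m = g(∇_{e_j} X, e_m)` the
two parts are the divergence and the curl. -/
theorem sum_mul_eq_neg_trace_add_skew {n : ℕ} (E : Fin n → R)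
    (hE : ∀ i j, E i * E j + E j * E i = (if i = j then (-2 : ℂ) else 0) • 1)
    (a : Fin n → Fin n → ℂ) :
    ∑ j, ∑ m, a j m • (E j * E m) =
      -((∑ j, a j j) • 1) + ∑ m, ∑ j ∈ Finset.Ioi m, (a m j - a j m) • (E m * E j) := by
  have hsq : ∀ i, E i * E i = -1 := by
    intro i
    have h := hE i i
    rw [if_pos rfl, ← two_smul ℂ, neg_smul, ← smul_neg] at h
    exact smul_right_injective R (two_ne_zero (α := ℂ)) h
  have hanti : ∀ i j, i ≠ j → E i * E j = -(E j * E i) := by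
    intro i j h
    have := hE i j
    rw [if_neg h, zero_smul] at this
    exact eq_neg_of_add_eq_zero_left this
  have hsplit : ∀ j, ∑ m, a j m • (E j * E m) = a j j • (E j * E j) +
      (∑ m ∈ Finset.Ioi j, a j m • (E j * E m) + ∑ m ∈ Finset.Iio j, a j m • (E j * E m)) := by
    intro j
    have hu : (Finset.univ : Finset (Fin n)) =
        insert j (Finset.Ioi j ∪ Finset.Iio j) := by
      ext m
      simp only [Finset.mem_univ, Finset.mem_insert, Finset.mem_union, Finset.mem_Ioi,
        Finset.mem_Iio, true_iff]
      omega
    rw [hu, Finset.sum_insert (by simp), Finset.sum_union]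
    rw [Finset.disjoint_left]
    simp only [Finset.mem_Ioi, Finset.mem_Iio]
    omega
  have hswap : ∑ j, ∑ m ∈ Finset.Iio j, a j m • (E j * E m) =
      ∑ m, ∑ j ∈ Finset.Ioi m, -(a j m • (E m * E j)) := by
    rw [Finset.sum_comm' (t' := Finset.univ) (s' := fun m ↦ Finset.Ioi m) (by simp)]
    refine Finset.sum_congr rfl fun m _ ↦ Finset.sum_congr rfl fun j hj ↦ ?_
    rw [hanti j m (Finset.mem_Ioi.1 hj).ne', smul_neg]
  simp only [hsplit, Finset.sum_add_distrib, hswap, hsq]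
  congr 1
  · simp [Finset.sum_smul]
  · simp only [← Finset.sum_add_distrib, sub_smul]
    simp only [sub_eq_add_neg]

/-- Reduces `A⁻¹ (D A) = B` to `D A = A B`, avoiding any explicit inverse. -/
theorem ring_inverse_apply_eq {V : Type*} [AddCommGroup V] [Module ℂ V] {A : Module.End ℂ V}
    (hA : IsUnit A) {u v : V} (h : u = A v) : Ring.inverse A u = v := by
  rw [h, ← Module.End.mul_apply, Ring.inverse_mul_cancel A hA, Module.End.one_apply]

end Algebra

/-! ### Chain and product rules for vector-valued functions on a manifold -/

section Calculus

variable {E H M F G K : Type*} [NormedAddCommGroup E] [NormedSpace ℝ E] [TopologicalSpace H]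
  {I : ModelWithCorners ℝ E H} [TopologicalSpace M] [ChartedSpace H M]
  [NormedAddCommGroup F] [NormedSpace ℝ F] [NormedAddCommGroup G] [NormedSpace ℝ G]
  [NormedAddCommGroup K] [NormedSpace ℝ K]

theorem mvfderiv_continuousLinearMap_comp (L : F →L[ℝ] G) {f : M → F} {x : M}
    (hf : MDifferentiableAt I 𝓘(ℝ, F) f x) (v : TangentSpace I x) :
    mvfderiv I (fun y ↦ L (f y)) x v = L (mvfderiv I f x v) := by
  have h := mfderiv_comp_apply x (g := L) (I' := 𝓘(ℝ, F)) (I'' := 𝓘(ℝ, G))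
    L.differentiableAt.mdifferentiableAt hf v
  rw [mfderiv_eq_fderiv, L.fderiv] at h
  exact h

theorem mvfderiv_bilinear (B : F →L[ℝ] G →L[ℝ] K) {f : M → F} {g : M → G} {x : M}
    (hf : MDifferentiableAt I 𝓘(ℝ, F) f x) (hg : MDifferentiableAt I 𝓘(ℝ, G) g x)
    (v : TangentSpace I x) :
    mvfderiv I (fun y ↦ B (f y) (g y)) x v =
      B (f x) (mvfderiv I g x v) + B (mvfderiv I f x v) (g x) := by
  have hB := B.isBoundedBilinearMap.hasFDerivAt (f x, g x)
  have h := mfderiv_comp_apply x (g := fun p : F × G ↦ B p.1 p.2) (I' := 𝓘(ℝ, F × G))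
    (I'' := 𝓘(ℝ, K)) (f := fun y ↦ (f y, g y))
    hB.differentiableAt.mdifferentiableAt (hf.prodMk_space hg) v
  rw [mfderiv_eq_fderiv, hB.fderiv] at h
  have hp : HasMFDerivAt I 𝓘(ℝ, F × G) (fun y ↦ (f y, g y)) x
      ((mvfderiv I f x).prod (mvfderiv I g x)) :=
    ⟨hf.hasMFDerivAt.1.prodMk hg.hasMFDerivAt.1, hf.hasMFDerivAt.2.prodMk hg.hasMFDerivAt.2⟩
  rw [hp.mfderiv] at h
  exact h

theorem mvfderiv_congr_of_eventuallyEq {f g : M → F} {x : M} (h : f =ᶠ[nhds x] g)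
    (v : TangentSpace I x) : mvfderiv I f x v = mvfderiv I g x v := by
  have := h.mfderiv_eq (I := I) (I' := 𝓘(ℝ, F))
  exact DFunLike.congr_fun this v

theorem mvfderiv_exp {f : M → ℝ} {x : M} (hf : MDifferentiableAt I 𝓘(ℝ, ℝ) f x)
    (v : TangentSpace I x) :
    mvfderiv I (fun y ↦ Real.exp (f y)) x v = Real.exp (f x) * mvfderiv I f x v := by
  have h := mfderiv_comp_apply x (g := Real.exp) (I' := 𝓘(ℝ, ℝ)) (I'' := 𝓘(ℝ, ℝ))
    Real.differentiable_exp.differentiableAt.mdifferentiableAt hf v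
  rw [mfderiv_eq_fderiv] at h
  have h' (t : ℝ) : fderiv ℝ Real.exp (f x) t = Real.exp (f x) * t := by
    rw [fderiv_eq_smul_deriv, Real.deriv_exp, smul_eq_mul, mul_comm]
  exact h.trans (h' _)

end Calculus
-- Clifford action on a fixed complex module
section Module

variable {n : ℕ} {Δ : Type*} [NormedAddCommGroup Δ] [NormedSpace ℂ Δ]
  (ρ : Cl n →ₐ[ℝ] Module.End ℂ Δ)

theorem real_smul_end (r : ℝ) (T : Module.End ℂ Δ) : r • T = (r : ℂ) • T := by
  ext u
  simp

/-- Polarization of `v * v = -|v|²`. -/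
theorem rep_ι_anticomm (v w : Eu n) :
    ρ (CliffordAlgebra.ι (negNormSq n) v) * ρ (CliffordAlgebra.ι (negNormSq n) w) +
      ρ (CliffordAlgebra.ι (negNormSq n) w) * ρ (CliffordAlgebra.ι (negNormSq n) v) =
      ((-2 * inner ℝ v w : ℝ) : ℂ) • 1 := by
  rw [← map_mul ρ, ← map_mul ρ, ← map_add ρ, CliffordAlgebra.ι_mul_ι_add_swap, AlgHom.commutes,
    Algebra.algebraMap_eq_smul_one, real_smul_end]
  congr 2
  simp only [negNormSq, QuadraticMap.polar, _root_.neg_apply,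
    LinearMap.BilinMap.toQuadraticMap_apply, innerₗ_apply_apply, inner_add_left, inner_add_right]
  rw [real_inner_comm v w]
  ring

variable [FiniteDimensional ℂ Δ]

/-- The Clifford action of `ℝⁿ` on a complex Clifford module, as a bounded bilinear map. -/
noncomputable def cliffAction : Eu n →L[ℝ] Δ →L[ℝ] Δ :=
  LinearMap.toContinuousLinearMap
    { toFun := fun w ↦ LinearMap.toContinuousLinearMap
        ((ρ (CliffordAlgebra.ι (negNormSq n) w)).restrictScalars ℝ)
      map_add' := fun v w ↦ by ext u; simp
      map_smul' := fun r w ↦ by ext u; simp }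

end Module

/-! ### Frames, Clifford multiplication and local expressions of spinor fields -/

section Manifold

variable {n : ℕ} {M : Type*} [TopologicalSpace M] [ChartedSpace (Eu n) M]
  [RiemannianBundle (fun x : M ↦ TangentSpace (𝓡 n) x)] [IsManifold (𝓡 n) ∞ M]

namespace SpinStructure

variable {ι : Type*} (σ : SpinStructure n M ι)

theorem span_frame {a : ι} {x : M} (hx : x ∈ σ.baseSet a) :
    Submodule.span ℝ (Set.range fun i ↦ σ.frame a i x) = ⊤ := by
  have : FiniteDimensional ℝ (TangentSpace (𝓡 n) x) :=
    inferInstanceAs (FiniteDimensional ℝ (Eu n))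
  refine (σ.orthonormal_frame a x hx).linearIndependent.span_eq_top_of_card_eq_finrank' ?_
  have : Module.finrank ℝ (TangentSpace (𝓡 n) x) = Module.finrank ℝ (Eu n) := rfl
  simp [this]

/-- The orthonormal basis of a tangent space given by a frame of the spin structure. -/
noncomputable def frameBasis {a : ι} {x : M} (hx : x ∈ σ.baseSet a) :
    OrthonormalBasis (Fin n) ℝ (TangentSpace (𝓡 n) x) :=
  OrthonormalBasis.mk (σ.orthonormal_frame a x hx) (σ.span_frame hx).ge

theorem frameBasis_apply {a : ι} {x : M} (hx : x ∈ σ.baseSet a) (i : Fin n) :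
    σ.frameBasis hx i = σ.frame a i x := by
  simp [frameBasis]

theorem inner_coords {a : ι} {x : M} (hx : x ∈ σ.baseSet a) (v w : TangentSpace (𝓡 n) x) :
    inner ℝ (σ.coords a x v) (σ.coords a x w) = inner ℝ v w := by
  rw [← (σ.frameBasis hx).sum_inner_mul_inner v w]
  simp only [coords, PiLp.inner_apply, frameBasis_apply]
  refine Finset.sum_congr rfl fun i _ ↦ ?_
  rw [real_inner_comm v]
  simp [mul_comm]

theorem coords_add (a : ι) (x : M) (v w : TangentSpace (𝓡 n) x) :
    σ.coords a x (v + w) = σ.coords a x v + σ.coords a x w := by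
  ext i
  simp [coords, inner_add_right]

theorem coords_smul (a : ι) (x : M) (r : ℝ) (v : TangentSpace (𝓡 n) x) :
    σ.coords a x (r • v) = r • σ.coords a x v := by
  ext i
  simp [coords, inner_smul_right]

variable {Δ : Type*} [NormedAddCommGroup Δ] [NormedSpace ℂ Δ]
  (ρ : Cl n →ₐ[ℝ] Module.End ℂ Δ)

/-- The lift `g` acts on frame coordinates by `v ↦ g v g⁻¹`, and `(g v g⁻¹) g = g v`. Hence Clifford
multiplication does not depend on the frame used to define it. -/
theorem coordChange_cliff {a b : ι} {y : M} (hy : y ∈ σ.baseSet a ∩ σ.baseSet b)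
    (v : TangentSpace (𝓡 n) y) (u : Δ) :
    ρ (σ.lift a b y : Cl n) (ρ (CliffordAlgebra.ι (negNormSq n) (σ.coords a y v)) u) =
      ρ (CliffordAlgebra.ι (negNormSq n) (σ.coords b y v)) (ρ (σ.lift a b y : Cl n) u) := by
  have h := σ.lift_frame a b y hy v
  have hinv : (((σ.lift a b y)⁻¹ : Spin n) : Cl n) * (σ.lift a b y : Cl n) = 1 := by
    rw [← Submonoid.coe_mul, inv_mul_cancel, Submonoid.coe_one]
  have h' : CliffordAlgebra.ι (negNormSq n) (σ.coords b y v) * (σ.lift a b y : Cl n) =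
      (σ.lift a b y : Cl n) * CliffordAlgebra.ι (negNormSq n) (σ.coords a y v) := by
    simp only [coords]
    rw [h, mul_assoc, hinv, mul_one]
  rw [← Module.End.mul_apply, ← Module.End.mul_apply, ← map_mul, ← map_mul, h']

variable [FiniteDimensional ℂ Δ]

theorem cliff_add (x : M) (v w : TangentSpace (𝓡 n) x) :
    σ.cliff ρ x (v + w) = σ.cliff ρ x v + σ.cliff ρ x w := by
  simp only [cliff, coords_add, map_add]
  rfl

theorem cliff_smul (x : M) (r : ℝ) (v : TangentSpace (𝓡 n) x) :
    σ.cliff ρ x (r • v) = (r : ℂ) • σ.cliff ρ x v := by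
  simp only [cliff, coords_smul, map_smul, real_smul_end]
  rfl

theorem cliff_zero (x : M) : σ.cliff ρ x 0 = 0 := by
  simpa using σ.cliff_smul ρ x 0 0

theorem cliff_sum {κ : Type*} (s : Finset κ) (x : M) (v : κ → TangentSpace (𝓡 n) x) :
    σ.cliff ρ x (∑ j ∈ s, v j) = ∑ j ∈ s, σ.cliff ρ x (v j) := by
  classical
  induction s using Finset.induction_on with
  | empty => simp [cliff_zero]
  | insert j s hj ih => rw [Finset.sum_insert hj, Finset.sum_insert hj, cliff_add, ih]

theorem cliff_anticomm (x : M) (v w : TangentSpace (𝓡 n) x) :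
    σ.cliff ρ x v * σ.cliff ρ x w + σ.cliff ρ x w * σ.cliff ρ x v =
      ((-2 * inner ℝ v w : ℝ) : ℂ) • 1 := by
  rw [← σ.inner_coords (σ.mem_baseSet_at x) v w]
  exact rep_ι_anticomm ρ _ _

theorem cliff_sq (x : M) (v : TangentSpace (𝓡 n) x) :
    σ.cliff ρ x v * σ.cliff ρ x v = ((-(‖v‖ ^ 2) : ℝ) : ℂ) • 1 := by
  have h := σ.cliff_anticomm ρ x v v
  rw [real_inner_self_eq_norm_sq, ← two_smul ℂ] at h
  have h2 : (((-2 * ‖v‖ ^ 2 : ℝ) : ℂ) • (1 : Module.End ℂ (σ.Spinor ρ x))) =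
      (2 : ℂ) • (((-(‖v‖ ^ 2) : ℝ) : ℂ) • 1) := by
    rw [smul_smul]
    push_cast
    congr 1
    ring
  rw [h2] at h
  exact smul_right_injective _ (two_ne_zero (α := ℂ)) h

theorem cliff_orthonormal {x : M} {b : Fin n → TangentSpace (𝓡 n) x} (hb : Orthonormal ℝ b)
    (i j : Fin n) :
    σ.cliff ρ x (b i) * σ.cliff ρ x (b j) + σ.cliff ρ x (b j) * σ.cliff ρ x (b i) =
      (if i = j then (-2 : ℂ) else 0) • 1 := by
  rw [cliff_anticomm, orthonormal_iff_ite.1 hb i j]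
  split_ifs <;> simp

/-- `cliff` at `y` uses the frame `indexAt y`, which may jump with `y`. In one fixed frame it
becomes a constant bilinear map, which can be differentiated. -/
theorem localRep_cliff (X : ∀ x : M, TangentSpace (𝓡 n) x) (ψ : ∀ x, σ.Spinor ρ x) {a : ι} {y : M}
    (hy : y ∈ σ.baseSet a) :
    σ.localRep ρ (fun y ↦ σ.cliff ρ y (X y) (ψ y)) a y =
      cliffAction ρ (σ.coords a y (X y)) (σ.localRep ρ ψ a y) :=
  σ.coordChange_cliff ρ ⟨σ.mem_baseSet_at y, hy⟩ (X y) (ψ y)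

theorem localRep_smul (h : M → ℝ) (ψ : ∀ x, σ.Spinor ρ x) (a : ι) (y : M) :
    σ.localRep ρ (fun y ↦ (h y : ℂ) • ψ y) a y = h y • σ.localRep ρ ψ a y := by
  refine (map_smul (ρ (σ.lift (σ.indexAt y) a y : Cl n)) (h y : ℂ) (ψ y)).trans ?_
  exact Complex.coe_smul (h y) _

theorem localRep_self (ψ : ∀ x, σ.Spinor ρ x) (x : M) :
    σ.localRep ρ ψ (σ.indexAt x) x = ψ x :=
  (σ.spinorCore ρ).coordChange_self _ _ (σ.mem_baseSet_at x) _

theorem mdifferentiableAt_localRep_iff (ψ : ∀ x, σ.Spinor ρ x) (x : M) :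
    MDifferentiableAt (𝓡 n) ((𝓡 n).prod 𝓘(ℝ, Δ)) (fun y ↦ TotalSpace.mk' Δ y (ψ y)) x ↔
      MDifferentiableAt (𝓡 n) 𝓘(ℝ, Δ) (σ.localRep ρ ψ (σ.indexAt x)) x :=
  mdifferentiableAt_section (𝓡 n) ψ

theorem contMDiffAt_localRep_iff (ψ : ∀ x, σ.Spinor ρ x) (x : M) :
    ContMDiffAt (𝓡 n) ((𝓡 n).prod 𝓘(ℝ, Δ)) ∞ (fun y ↦ TotalSpace.mk' Δ y (ψ y)) x ↔
      ContMDiffAt (𝓡 n) 𝓘(ℝ, Δ) ∞ (σ.localRep ρ ψ (σ.indexAt x)) x :=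
  contMDiffAt_section x

theorem baseSet_mem_nhds {a : ι} {x : M} (hx : x ∈ σ.baseSet a) : σ.baseSet a ∈ nhds x :=
  (σ.isOpen_baseSet a).mem_nhds hx

theorem isSmoothEnd_smul {h : M → ℝ} (hh : ContMDiff (𝓡 n) 𝓘(ℝ, ℝ) ∞ h) :
    σ.IsSmoothEnd ρ (fun x ↦ (h x : ℂ) • 1) := by
  intro x ψ hψ
  rw [contMDiffAt_localRep_iff] at hψ ⊢
  refine ((hh x).smul hψ).congr_of_eventuallyEq (.of_forall fun y ↦ ?_)
  exact σ.localRep_smul ρ h ψ _ y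

variable [IsContMDiffRiemannianBundle (𝓡 n) ∞ (Eu n) (fun x : M ↦ TangentSpace (𝓡 n) x)]

theorem contMDiffAt_coords {X : ∀ x : M, TangentSpace (𝓡 n) x} {a : ι} {x : M}
    (hx : x ∈ σ.baseSet a)
    (hX : ContMDiffAt (𝓡 n) (𝓡 n).tangent ∞ (fun y ↦ (⟨y, X y⟩ : TangentBundle (𝓡 n) M)) x) :
    ContMDiffAt (𝓡 n) 𝓘(ℝ, Eu n) ∞ (fun y ↦ σ.coords a y (X y)) x := by
  have h : ContMDiffAt (𝓡 n) 𝓘(ℝ, Fin n → ℝ) ∞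
      (fun y i ↦ (inner ℝ (σ.frame a i y) (X y) : ℝ)) x :=
    contMDiffAt_pi_space.2 fun i ↦
      ((σ.contMDiffOn_frame a i).contMDiffAt (σ.baseSet_mem_nhds hx)).inner_bundle hX
  exact (EuclideanSpace.equiv (Fin n) ℝ).symm.contDiff.contMDiff.contMDiffAt.comp x h

theorem isSmoothEnd_cliff {X : ∀ x : M, TangentSpace (𝓡 n) x}
    (hX : ContMDiff (𝓡 n) (𝓡 n).tangent ∞ (fun x ↦ (⟨x, X x⟩ : TangentBundle (𝓡 n) M))) :
    σ.IsSmoothEnd ρ (fun x ↦ σ.cliff ρ x (X x)) := by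
  intro x ψ hψ
  rw [contMDiffAt_localRep_iff] at hψ ⊢
  have hx := σ.mem_baseSet_at x
  have h : ContMDiffAt (𝓡 n) 𝓘(ℝ, Δ) ∞ (fun y ↦ cliffAction ρ (σ.coords (σ.indexAt x) y (X y))
      (σ.localRep ρ ψ (σ.indexAt x) y)) x :=
    ((cliffAction ρ).contDiff.contMDiff.contMDiffAt.comp x
      (σ.contMDiffAt_coords hx (hX x))).clm_apply hψ
  refine h.congr_of_eventuallyEq ?_
  filter_upwards [σ.baseSet_mem_nhds hx] with y hy
  exact σ.localRep_cliff ρ X ψ hy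

end SpinStructure
end Manifold
-- The spinor connection and parallelism of Clifford multiplication
section Manifold

variable {n : ℕ} {M : Type*} [TopologicalSpace M] [ChartedSpace (Eu n) M]
  [RiemannianBundle (fun x : M ↦ TangentSpace (𝓡 n) x)] [IsManifold (𝓡 n) ∞ M]

namespace SpinStructure

variable {ι : Type*} (σ : SpinStructure n M ι)
  {Δ : Type*} [NormedAddCommGroup Δ] [NormedSpace ℂ Δ] [FiniteDimensional ℂ Δ]
  (ρ : Cl n →ₐ[ℝ] Module.End ℂ Δ)
  (nabla : CovariantDerivative (𝓡 n) (Eu n) (fun x : M ↦ TangentSpace (𝓡 n) x))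

/-- The connection form of the spinor connection in the frame at `x`. -/
noncomputable def connForm (x : M) (v : TangentSpace (𝓡 n) x) (i j : Fin n) : ℝ :=
  inner ℝ (nabla (σ.frame (σ.indexAt x) i) x v) (σ.frame (σ.indexAt x) j x)

/-- The zeroth-order part of the spinor connection. -/
noncomputable def spinForm (x : M) (v : TangentSpace (𝓡 n) x) : Module.End ℂ (σ.Spinor ρ x) :=
  ∑ i, ∑ j, (σ.connForm nabla x v i j : ℂ) •
    (σ.cliff ρ x (σ.frame (σ.indexAt x) i x) * σ.cliff ρ x (σ.frame (σ.indexAt x) j x))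

theorem spinNabla_eq (ψ : ∀ x, σ.Spinor ρ x) (x : M) (v : TangentSpace (𝓡 n) x) :
    σ.spinNabla ρ nabla ψ x v =
      (show σ.Spinor ρ x from mvfderiv (𝓡 n) (σ.localRep ρ ψ (σ.indexAt x)) x v) +
        (1 / 4 : ℂ) • σ.spinForm ρ nabla x v (ψ x) := by
  simp only [spinNabla, spinForm, connForm, LinearMap.sum_apply, LinearMap.smul_apply,
    Module.End.mul_apply]
  norm_num

theorem spinNabla_smul {h : M → ℝ} {ψ : ∀ x, σ.Spinor ρ x} {x : M}
    (hh : MDifferentiableAt (𝓡 n) 𝓘(ℝ, ℝ) h x)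
    (hψ : MDifferentiableAt (𝓡 n) ((𝓡 n).prod 𝓘(ℝ, Δ)) (fun y ↦ TotalSpace.mk' Δ y (ψ y)) x)
    (v : TangentSpace (𝓡 n) x) :
    σ.spinNabla ρ nabla (fun y ↦ (h y : ℂ) • ψ y) x v =
      (h x : ℂ) • σ.spinNabla ρ nabla ψ x v + ((mvfderiv (𝓡 n) h x v : ℝ) : ℂ) • ψ x := by
  rw [mdifferentiableAt_localRep_iff] at hψ
  have h1 : mvfderiv (𝓡 n) (σ.localRep ρ (fun y ↦ (h y : ℂ) • ψ y) (σ.indexAt x)) x v =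
      (h x : ℂ) • mvfderiv (𝓡 n) (σ.localRep ρ ψ (σ.indexAt x)) x v +
        ((mvfderiv (𝓡 n) h x v : ℝ) : ℂ) • (σ.localRep ρ ψ (σ.indexAt x) x) := by
    have : σ.localRep ρ (fun y ↦ (h y : ℂ) • ψ y) (σ.indexAt x) =
        h • σ.localRep ρ ψ (σ.indexAt x) := funext (σ.localRep_smul ρ h ψ _)
    rw [this, mvfderiv_smul hh hψ]
    simp
  rw [localRep_self] at h1
  rw [spinNabla_eq, spinNabla_eq, map_smul, smul_add, smul_comm (1 / 4 : ℂ), add_right_comm]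
  congr 1

theorem mdifferentiableAt_frame (x : M) (i : Fin n) :
    MDifferentiableAt (𝓡 n) (𝓡 n).tangent
      (fun y ↦ (⟨y, σ.frame (σ.indexAt x) i y⟩ : TangentBundle (𝓡 n) M)) x :=
  ((σ.contMDiffOn_frame (σ.indexAt x) i).contMDiffAt
    (σ.baseSet_mem_nhds (σ.mem_baseSet_at x))).mdifferentiableAt (by simp)

variable {nabla}

theorem cliff_eq_sum_frame (x : M) (v : TangentSpace (𝓡 n) x) :
    σ.cliff ρ x v = ∑ k, ((inner ℝ (σ.frame (σ.indexAt x) k x) v : ℝ) : ℂ) •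
      σ.cliff ρ x (σ.frame (σ.indexAt x) k x) := by
  have h := (σ.frameBasis (σ.mem_baseSet_at x)).sum_repr' v
  simp only [frameBasis_apply] at h
  conv_lhs => rw [← h]
  rw [cliff_sum]
  simp only [cliff_smul]

/-- Needed for the derivative of a coordinate function, which is a vector of `ℝⁿ` rather than a
tangent vector. -/
theorem rep_eq_sum_frame (x : M) (w : Eu n) :
    (ρ (CliffordAlgebra.ι (negNormSq n) w) : Module.End ℂ Δ) =
      ∑ k, (w k : ℂ) • (σ.cliff ρ x (σ.frame (σ.indexAt x) k x) : Module.End ℂ Δ) := by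
  have h : σ.coords (σ.indexAt x) x (∑ k, w k • σ.frame (σ.indexAt x) k x) = w := by
    ext i
    simp only [coords, inner_sum, inner_smul_right,
      orthonormal_iff_ite.1 (σ.orthonormal_frame _ x (σ.mem_baseSet_at x))]
    simp
  conv_lhs => rw [← h]
  have h' := σ.cliff_sum ρ Finset.univ x (fun k ↦ w k • σ.frame (σ.indexAt x) k x)
  simp only [cliff_smul] at h'
  exact h'

variable [IsContMDiffRiemannianBundle (𝓡 n) ∞ (Eu n) (fun x : M ↦ TangentSpace (𝓡 n) x)]

theorem _root_.DiracSchrodinger.IsLeviCivita.mvfderiv_inner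
    {nabla : CovariantDerivative (𝓡 n) (Eu n) (fun x : M ↦ TangentSpace (𝓡 n) x)}
    (hnabla : IsLeviCivita nabla) {x : M} {Y Z : ∀ x : M, TangentSpace (𝓡 n) x}
    (hY : MDifferentiableAt (𝓡 n) (𝓡 n).tangent (fun y ↦ (⟨y, Y y⟩ : TangentBundle (𝓡 n) M)) x)
    (hZ : MDifferentiableAt (𝓡 n) (𝓡 n).tangent (fun y ↦ (⟨y, Z y⟩ : TangentBundle (𝓡 n) M)) x)
    (v : TangentSpace (𝓡 n) x) :
    mvfderiv (𝓡 n) (fun y ↦ (inner ℝ (Y y) (Z y) : ℝ)) x v =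
      inner ℝ (nabla Y x v) (Z x) + inner ℝ (Y x) (nabla Z x v) := by
  have : IsContMDiffRiemannianBundle (𝓡 n) 1 (Eu n) (fun x : M ↦ TangentSpace (𝓡 n) x) :=
    IsContMDiffRiemannianBundle.of_le (n := ∞) (by norm_cast)
  classical
  -- Metric compatibility is stated along a vector field; only its value at `x` matters, so `v` is
  -- extended by zero.
  have h := hnabla.2.mvfderiv_inner_eq (Function.update (fun _ ↦ 0) x v) hY hZ
  simpa using h

/-- Differentiate the locally constant products `g(ε_i, ε_j)` using metric compatibility. -/
theorem connForm_skew (hnabla : IsLeviCivita nabla) (x : M) (v : TangentSpace (𝓡 n) x)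
    (i j : Fin n) : σ.connForm nabla x v i j = -σ.connForm nabla x v j i := by
  have h := hnabla.mvfderiv_inner (σ.mdifferentiableAt_frame x i) (σ.mdifferentiableAt_frame x j) v
  have hc : (fun y ↦ (inner ℝ (σ.frame (σ.indexAt x) i y) (σ.frame (σ.indexAt x) j y) : ℝ))
      =ᶠ[nhds x] fun _ ↦ if i = j then 1 else 0 := by
    filter_upwards [σ.baseSet_mem_nhds (σ.mem_baseSet_at x)] with y hy
    exact orthonormal_iff_ite.1 (σ.orthonormal_frame _ y hy) i j
  rw [mvfderiv_congr_of_eventuallyEq hc, mvfderiv_const, _root_.zero_apply] at h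
  simp only [connForm]
  rw [real_inner_comm _ (σ.frame (σ.indexAt x) i x)] at h
  linarith

theorem spinForm_commutator (hnabla : IsLeviCivita nabla) (x : M) (v : TangentSpace (𝓡 n) x)
    (k : Fin n) :
    σ.spinForm ρ nabla x v * σ.cliff ρ x (σ.frame (σ.indexAt x) k x) -
      σ.cliff ρ x (σ.frame (σ.indexAt x) k x) * σ.spinForm ρ nabla x v =
      (4 : ℂ) • ∑ j, (σ.connForm nabla x v k j : ℂ) •
        σ.cliff ρ x (σ.frame (σ.indexAt x) j x) :=
  spin_commutator (fun i ↦ σ.cliff ρ x (σ.frame (σ.indexAt x) i x))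
    (σ.cliff_orthonormal ρ (σ.orthonormal_frame _ x (σ.mem_baseSet_at x)))
    (fun i j ↦ (σ.connForm nabla x v i j : ℂ))
    (fun i j ↦ by rw [σ.connForm_skew hnabla]; push_cast; rfl) k

theorem spinForm_commutator_cliff (hnabla : IsLeviCivita nabla) (x : M)
    (v w : TangentSpace (𝓡 n) x) :
    σ.spinForm ρ nabla x v * σ.cliff ρ x w - σ.cliff ρ x w * σ.spinForm ρ nabla x v =
      (4 : ℂ) • ∑ k, ((∑ j, inner ℝ (σ.frame (σ.indexAt x) j x) w * σ.connForm nabla x v j k : ℝ) :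
        ℂ) • σ.cliff ρ x (σ.frame (σ.indexAt x) k x) := by
  rw [σ.cliff_eq_sum_frame ρ x w]
  simp only [Finset.mul_sum, Finset.sum_mul, mul_smul_comm, smul_mul_assoc,
    ← Finset.sum_sub_distrib, ← smul_sub, σ.spinForm_commutator ρ hnabla]
  simp only [Complex.ofReal_sum, Finset.sum_smul, Complex.ofReal_mul, mul_smul]
  rw [Finset.sum_comm, Finset.smul_sum]
  refine Finset.sum_congr rfl fun k _ ↦ ?_
  rw [smul_comm, Finset.smul_sum]

/-- Metric compatibility applied to `g(ε_k, X)`; expanding `X` in the frame turns `g(∇_v ε_k, X)`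
into connection coefficients, and skewness gives the minus sign. -/
theorem mvfderiv_coords (hnabla : IsLeviCivita nabla) {X : ∀ x : M, TangentSpace (𝓡 n) x} {x : M}
    (hX : ContMDiffAt (𝓡 n) (𝓡 n).tangent ∞ (fun y ↦ (⟨y, X y⟩ : TangentBundle (𝓡 n) M)) x)
    (v : TangentSpace (𝓡 n) x) (k : Fin n) :
    (mvfderiv (𝓡 n) (fun y ↦ σ.coords (σ.indexAt x) y (X y)) x v) k =
      inner ℝ (σ.frame (σ.indexAt x) k x) (nabla X x v) -
        ∑ j, inner ℝ (σ.frame (σ.indexAt x) j x) (X x) * σ.connForm nabla x v j k := by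
  have hc := (σ.contMDiffAt_coords (σ.mem_baseSet_at x) hX).mdifferentiableAt (by simp)
  have h1 := mvfderiv_continuousLinearMap_comp (EuclideanSpace.proj (𝕜 := ℝ) k) hc v
  have h2 := hnabla.mvfderiv_inner (σ.mdifferentiableAt_frame x k)
    (hX.mdifferentiableAt (by simp)) v
  have h3 : (inner ℝ (nabla (σ.frame (σ.indexAt x) k) x v) (X x) : ℝ) =
      ∑ j, inner ℝ (σ.frame (σ.indexAt x) j x) (X x) * σ.connForm nabla x v k j := by
    rw [← (σ.frameBasis (σ.mem_baseSet_at x)).sum_inner_mul_inner]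
    simp only [frameBasis_apply, connForm]
    exact Finset.sum_congr rfl fun j _ ↦ mul_comm _ _
  rw [h3] at h2
  -- The `k`-th coordinate of `X` is `g(ε_k, X)` by definition, so `h1` and `h2` concern the same
  -- derivative.
  refine (h1.symm.trans h2).trans ?_
  simp only [σ.connForm_skew hnabla x v k, mul_neg, Finset.sum_neg_distrib]
  ring

/-- Clifford multiplication is parallel: `∇_v (c(X)) = c(∇_v X)`. -/
theorem endNabla_cliff (hnabla : IsLeviCivita nabla) {X : ∀ x : M, TangentSpace (𝓡 n) x} {x : M}
    (hX : ContMDiffAt (𝓡 n) (𝓡 n).tangent ∞ (fun y ↦ (⟨y, X y⟩ : TangentBundle (𝓡 n) M)) x)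
    {ψ : ∀ x, σ.Spinor ρ x}
    (hψ : MDifferentiableAt (𝓡 n) ((𝓡 n).prod 𝓘(ℝ, Δ)) (fun y ↦ TotalSpace.mk' Δ y (ψ y)) x)
    (v : TangentSpace (𝓡 n) x) :
    σ.endNabla ρ nabla (fun y ↦ σ.cliff ρ y (X y)) ψ x v = σ.cliff ρ x (nabla X x v) (ψ x) := by
  rw [mdifferentiableAt_localRep_iff] at hψ
  have hx := σ.mem_baseSet_at x
  have hc := (σ.contMDiffAt_coords hx hX).mdifferentiableAt (by simp)
  have heq : σ.localRep ρ (fun y ↦ σ.cliff ρ y (X y) (ψ y)) (σ.indexAt x) =ᶠ[nhds x]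
      fun y ↦ cliffAction ρ (σ.coords (σ.indexAt x) y (X y)) (σ.localRep ρ ψ (σ.indexAt x) y) := by
    filter_upwards [σ.baseSet_mem_nhds hx] with y hy
    exact σ.localRep_cliff ρ X ψ hy
  have h1 := (mvfderiv_congr_of_eventuallyEq heq v).trans
    (mvfderiv_bilinear (cliffAction ρ) hc hψ v)
  rw [localRep_self] at h1
  set w : Eu n := mvfderiv (𝓡 n) (fun y ↦ σ.coords (σ.indexAt x) y (X y)) x v with hw
  set d : σ.Spinor ρ x := mvfderiv (𝓡 n) (σ.localRep ρ ψ (σ.indexAt x)) x v with hd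
  -- Product rule: the derivative falls on `ψ` (giving `d`) or on the coordinates of `X` (giving
  -- `w`).
  have h2 : σ.spinNabla ρ nabla (fun y ↦ σ.cliff ρ y (X y) (ψ y)) x v =
      (σ.cliff ρ x (X x) d +
        (∑ k, (w k : ℂ) • σ.cliff ρ x (σ.frame (σ.indexAt x) k x)) (ψ x)) +
        (1 / 4 : ℂ) • σ.spinForm ρ nabla x v (σ.cliff ρ x (X x) (ψ x)) := by
    rw [spinNabla_eq]
    congr 1
    refine h1.trans ?_
    congr 1
    exact LinearMap.congr_fun (σ.rep_eq_sum_frame ρ x w) (ψ x)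
  have h3 : σ.spinNabla ρ nabla ψ x v = d + (1 / 4 : ℂ) • σ.spinForm ρ nabla x v (ψ x) :=
    σ.spinNabla_eq ρ nabla ψ x v
  have h4 := LinearMap.congr_fun (σ.spinForm_commutator_cliff ρ hnabla x v (X x)) (ψ x)
  have h5 : ∑ k, (w k : ℂ) • σ.cliff ρ x (σ.frame (σ.indexAt x) k x) =
      σ.cliff ρ x (nabla X x v) - ∑ k, ((∑ j, inner ℝ (σ.frame (σ.indexAt x) j x) (X x) *
        σ.connForm nabla x v j k : ℝ) : ℂ) • σ.cliff ρ x (σ.frame (σ.indexAt x) k x) := by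
    rw [σ.cliff_eq_sum_frame ρ x (nabla X x v), ← Finset.sum_sub_distrib]
    refine Finset.sum_congr rfl fun k _ ↦ ?_
    rw [hw, σ.mvfderiv_coords hnabla hX v k, Complex.ofReal_sub, sub_smul]
  rw [endNabla, h2, h3, h5]
  simp only [LinearMap.sub_apply, Module.End.mul_apply, LinearMap.smul_apply] at h4
  rw [LinearMap.sub_apply, map_add, map_smul]
  -- The 1/4 of the spinor connection cancels the 4 of the commutator, leaving the correction term
  -- of `h5`.
  have h6 := congrArg (fun z ↦ (1 / 4 : ℂ) • z) h4
  simp only [smul_smul, smul_sub] at h6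
  norm_num at h6
  norm_num
  rw [← h6]
  abel

end SpinStructure
end Manifold
-- The two integrating factors
section Manifold

variable {n : ℕ} {M : Type*} [TopologicalSpace M] [ChartedSpace (Eu n) M]
  [RiemannianBundle (fun x : M ↦ TangentSpace (𝓡 n) x)] [IsManifold (𝓡 n) ∞ M]

namespace SpinStructure

variable {ι : Type*} (σ : SpinStructure n M ι)
  {Δ : Type*} [NormedAddCommGroup Δ] [NormedSpace ℂ Δ] [FiniteDimensional ℂ Δ]
  (ρ : Cl n →ₐ[ℝ] Module.End ℂ Δ)
  (nabla : CovariantDerivative (𝓡 n) (Eu n) (fun x : M ↦ TangentSpace (𝓡 n) x))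
  (e : ∀ x : M, OrthonormalBasis (Fin n) ℝ (TangentSpace (𝓡 n) x))

/-- Since `c(v)² = -|v|²`, the inverse is `-c(v)/|v|²`. -/
theorem isUnit_cliff {x : M} {v : TangentSpace (𝓡 n) x} (hv : v ≠ 0) :
    IsUnit (σ.cliff ρ x v) := by
  have hne : (((-(‖v‖ ^ 2) : ℝ)) : ℂ) ≠ 0 := by
    simpa using hv
  refine isUnit_iff_exists.2 ⟨(((-(‖v‖ ^ 2) : ℝ)) : ℂ)⁻¹ • σ.cliff ρ x v, ?_, ?_⟩
  · rw [mul_smul_comm, cliff_sq, smul_smul, inv_mul_cancel₀ hne, one_smul]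
  · rw [smul_mul_assoc, cliff_sq, smul_smul, inv_mul_cancel₀ hne, one_smul]

theorem isUnit_exp_smul (t : ℝ) (x : M) :
    IsUnit (((Real.exp t : ℝ) : ℂ) • (1 : Module.End ℂ (σ.Spinor ρ x))) := by
  rw [← Algebra.algebraMap_eq_smul_one]
  exact (IsUnit.mk0 _ (Complex.ofReal_ne_zero.2 (Real.exp_ne_zero t))).map (algebraMap ℂ _)

theorem spinNabla_exp_smul {f : M → ℝ} {ψ : ∀ x, σ.Spinor ρ x} {x : M}
    (hf : MDifferentiableAt (𝓡 n) 𝓘(ℝ, ℝ) f x)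
    (hψ : MDifferentiableAt (𝓡 n) ((𝓡 n).prod 𝓘(ℝ, Δ)) (fun y ↦ TotalSpace.mk' Δ y (ψ y)) x)
    (v : TangentSpace (𝓡 n) x) :
    σ.spinNabla ρ nabla (fun y ↦ ((Real.exp (f y) : ℝ) : ℂ) • ψ y) x v =
      ((Real.exp (f x) : ℝ) : ℂ) • (σ.spinNabla ρ nabla ψ x v +
        ((mvfderiv (𝓡 n) f x v : ℝ) : ℂ) • ψ x) := by
  have hexp : MDifferentiableAt (𝓡 n) 𝓘(ℝ, ℝ) (fun y ↦ Real.exp (f y)) x :=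
    Real.differentiable_exp.differentiableAt.mdifferentiableAt.comp x hf
  rw [σ.spinNabla_smul ρ nabla hexp hψ, mvfderiv_exp hf, Complex.ofReal_mul, mul_smul, smul_add]

theorem cliff_grad (f : M → ℝ) (x : M) :
    σ.cliff ρ x (grad e f x) =
      ∑ j, ((mvfderiv (𝓡 n) f x (e x j) : ℝ) : ℂ) • σ.cliff ρ x (e x j) := by
  rw [grad, cliff_sum]
  simp only [cliff_smul]

theorem dirac_exp_smul {f : M → ℝ} {ψ : ∀ x, σ.Spinor ρ x} {x : M}
    (hf : MDifferentiableAt (𝓡 n) 𝓘(ℝ, ℝ) f x)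
    (hψ : MDifferentiableAt (𝓡 n) ((𝓡 n).prod 𝓘(ℝ, Δ)) (fun y ↦ TotalSpace.mk' Δ y (ψ y)) x) :
    σ.dirac ρ nabla e (fun y ↦ ((Real.exp (f y) : ℝ) : ℂ) • ψ y) x =
      ((Real.exp (f x) : ℝ) : ℂ) • σ.diracSchrodinger ρ nabla e
        (fun y ↦ σ.cliff ρ y (grad e f y)) ψ x := by
  simp only [dirac, diracSchrodinger, σ.spinNabla_exp_smul ρ nabla hf hψ, map_smul, map_add,
    cliff_grad, LinearMap.sum_apply, LinearMap.smul_apply, Finset.sum_add_distrib,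
    ← Finset.smul_sum]

theorem isIntegratingFactor_exp {f : M → ℝ} (hf : ContMDiff (𝓡 n) 𝓘(ℝ, ℝ) ∞ f) :
    σ.IsIntegratingFactor ρ nabla e (fun x ↦ σ.cliff ρ x (grad e f x))
      (fun x ↦ ((Real.exp (f x) : ℝ) : ℂ) • 1) := by
  refine ⟨σ.isSmoothEnd_smul ρ (h := fun x ↦ Real.exp (f x))
    (Real.contDiff_exp.contMDiff.comp hf), fun x ↦ σ.isUnit_exp_smul ρ (f x) x,
    fun x ψ hψ ↦ ring_inverse_apply_eq (σ.isUnit_exp_smul ρ (f x) x) ?_⟩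
  have hfx : MDifferentiableAt (𝓡 n) 𝓘(ℝ, ℝ) f x := (hf x).mdifferentiableAt (by simp)
  simp only [endDirac, endNabla, LinearMap.smul_apply, Module.End.one_apply,
    σ.spinNabla_exp_smul ρ nabla hfx hψ, smul_add, add_sub_cancel_left, map_smul, cliff_grad,
    LinearMap.sum_apply, ← Finset.smul_sum]

theorem sum_cliff_mul_cliff (X : ∀ x : M, TangentSpace (𝓡 n) x) (x : M) :
    ∑ j, σ.cliff ρ x (e x j) * σ.cliff ρ x (nabla X x (e x j)) =
      -(((divergence nabla e X x : ℝ) : ℂ) • 1 - σ.curl ρ nabla e X x) := by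
  have h (j : Fin n) : σ.cliff ρ x (e x j) * σ.cliff ρ x (nabla X x (e x j)) =
      ∑ m, ((inner ℝ (nabla X x (e x j)) (e x m) : ℝ) : ℂ) •
        (σ.cliff ρ x (e x j) * σ.cliff ρ x (e x m)) := by
    conv_lhs => rw [← (e x).sum_repr' (nabla X x (e x j))]
    simp only [cliff_sum, cliff_smul, Finset.mul_sum, mul_smul_comm, real_inner_comm]
  simp only [h]
  rw [sum_mul_eq_neg_trace_add_skew _ (σ.cliff_orthonormal ρ (e x).orthonormal), neg_sub,
    sub_eq_neg_add, divergence, curl, Complex.ofReal_sum]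
  simp only [Complex.ofReal_sub]

variable {nabla} [IsContMDiffRiemannianBundle (𝓡 n) ∞ (Eu n) (fun x : M ↦ TangentSpace (𝓡 n) x)]

theorem isIntegratingFactor_cliff (hnabla : IsLeviCivita nabla)
    {X : ∀ x : M, TangentSpace (𝓡 n) x}
    (hX : ContMDiff (𝓡 n) (𝓡 n).tangent ∞ (fun x ↦ (⟨x, X x⟩ : TangentBundle (𝓡 n) M)))
    (hX0 : ∀ x, X x ≠ 0) :
    σ.IsIntegratingFactor ρ nabla e
      (fun x ↦ (((‖X x‖ ^ 2)⁻¹ : ℝ) : ℂ) • (σ.cliff ρ x (X x) *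
        (((divergence nabla e X x : ℝ) : ℂ) • 1 - σ.curl ρ nabla e X x)))
      (fun x ↦ σ.cliff ρ x (X x)) := by
  refine ⟨σ.isSmoothEnd_cliff ρ hX, fun x ↦ σ.isUnit_cliff ρ (hX0 x),
    fun x ψ hψ ↦ ring_inverse_apply_eq (σ.isUnit_cliff ρ (hX0 x)) ?_⟩
  have h1 : σ.endDirac ρ nabla e (fun y ↦ σ.cliff ρ y (X y)) ψ x =
      (∑ j, σ.cliff ρ x (e x j) * σ.cliff ρ x (nabla X x (e x j))) (ψ x) := by
    simp only [endDirac, σ.endNabla_cliff ρ hnabla (hX x) hψ, LinearMap.sum_apply,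
      Module.End.mul_apply]
  have hne : (‖X x‖ ^ 2) ≠ 0 := by simpa using hX0 x
  -- On the right, `c(X) (|X|⁻² c(X)) = -1`, which matches the sign in `sum_cliff_mul_cliff`.
  rw [h1, sum_cliff_mul_cliff, ← Module.End.mul_apply, mul_smul_comm, ← mul_assoc, cliff_sq,
    smul_mul_assoc, one_mul, smul_smul, ← Complex.ofReal_mul, mul_neg, inv_mul_cancel₀ hne,
    Complex.ofReal_neg, Complex.ofReal_one, neg_one_smul]

end SpinStructure
end Manifold
end DiracSchrodinger

theorem theorem2 {n : ℕ} {M : Type*} [TopologicalSpace M] [ChartedSpace (DiracSchrodinger.Eu n) M]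
    [IsManifold (𝓡 n) ∞ M]
    [RiemannianBundle (fun x : M ↦ TangentSpace (𝓡 n) x)]
    [IsContMDiffRiemannianBundle (𝓡 n) ∞ (DiracSchrodinger.Eu n)
      (fun x : M ↦ TangentSpace (𝓡 n) x)]
    (nabla : CovariantDerivative (𝓡 n) (DiracSchrodinger.Eu n)
      (fun x : M ↦ TangentSpace (𝓡 n) x))
    (hnabla : DiracSchrodinger.IsLeviCivita nabla)
    {ι : Type*} (σ : DiracSchrodinger.SpinStructure n M ι)
    {Δ : Type*} [NormedAddCommGroup Δ] [NormedSpace ℂ Δ] [FiniteDimensional ℂ Δ]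
    (ρ : DiracSchrodinger.Cl n →ₐ[ℝ] Module.End ℂ Δ) (hρ : DiracSchrodinger.IsSpinorModule ρ)
    (e : ∀ x : M, OrthonormalBasis (Fin n) ℝ (TangentSpace (𝓡 n) x)) :
    (∀ f : M → ℝ, ContMDiff (𝓡 n) 𝓘(ℝ, ℝ) ∞ f →
      σ.IsIntegratingFactor ρ nabla e
          (fun x ↦ σ.cliff ρ x (DiracSchrodinger.grad e f x))
          (fun x ↦ ((Real.exp (f x) : ℝ) : ℂ) • 1) ∧
        ∀ (x : M) (ψ : ∀ y, σ.Spinor ρ y),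
          MDifferentiableAt (𝓡 n) ((𝓡 n).prod 𝓘(ℝ, Δ)) (fun y ↦ TotalSpace.mk' Δ y (ψ y)) x →
          σ.dirac ρ nabla e (fun y ↦ ((Real.exp (f y) : ℝ) : ℂ) • ψ y) x =
            ((Real.exp (f x) : ℝ) : ℂ) • σ.diracSchrodinger ρ nabla e
              (fun y ↦ σ.cliff ρ y (DiracSchrodinger.grad e f y)) ψ x) ∧
    (∀ X : ∀ x : M, TangentSpace (𝓡 n) x,
      ContMDiff (𝓡 n) (𝓡 n).tangent ∞ (fun x ↦ (⟨x, X x⟩ : TangentBundle (𝓡 n) M)) →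
      (∀ x, X x ≠ 0) →
      σ.IsIntegratingFactor ρ nabla e
        (fun x ↦ (((‖X x‖ ^ 2)⁻¹ : ℝ) : ℂ) • (σ.cliff ρ x (X x) *
          (((DiracSchrodinger.divergence nabla e X x : ℝ) : ℂ) • 1 - σ.curl ρ nabla e X x)))
        (fun x ↦ σ.cliff ρ x (X x))) := by
  exact ⟨fun f hf ↦ ⟨σ.isIntegratingFactor_exp ρ nabla e hf, fun x _ hψ ↦
    σ.dirac_exp_smul ρ nabla e ((hf x).mdifferentiableAt (by simp)) hψ⟩,
    fun _ hX hX0 ↦ σ.isIntegratingFactor_cliff ρ e hnabla hX hX0⟩
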